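/- Let $n\ge 0$, $\lambda_1,\dots,\lambda_n\in\mathbb C$ and $R_1,\dots,R_n>0$ be such that the set $$S=\{z\in\mathbb C:\ |z|\le 1,\ |z-\lambda_j|\ge R_j,\ j=1,\dots,n\}$$ is nonempty. Let $p(z,\bar z)=\sum_{k,l}p_{kl}z^k\bar z^l$ be a polynomial in $z$ and $\bar z$ with complex coefficients, write $p(S)=\{p(z,\bar z): z\in S\}$, and for an element $a$ of a unital $C^*$-algebra put $p(a,a^*)=\sum_{k,l}p_{kl}a^k(a^*)^l$. Then for every $\varepsilon>0$ and $\kappa>0$ there are constants $C$ and $\delta_0>0$, depending only on $p,\kappa,\varepsilon$ and on the fixed data $\lambda_j,R_j$ that define $S$, with the following property. Let $\delta<\delta_0$, let $\mu\in\mathbb C$ satisfy $\operatorname{dist}(\mu,p(S))\ge\kappa$, and let $a$ be an element of a unital $C^*$-algebra such that $\|a\|\le1$, $\|[a,a^*]\|\le\delta$ and, for $j=1,\dots,n$, $a-\lambda_j\mathbf 1$ is invertible with $\|(a-\lambda_j\mathbf 1)^{-1}\|\le R_j^{-1}$. Then $p(a,a^*)-\mu\mathbf 1$ is invertible and $$\|(p(a,a^*)-\mu\mathbf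 1)^{-1}\|\le\kappa^{-1}+\varepsilon+C\delta.$$ -/

import Mathlib

/-- The closed unit disk with `n` open holes of centres `lam j` and radii `R j` removed. -/
def holedDisk {n : ℕ} (lam : Fin n → ℂ) (R : Fin n → ℝ) : Set ℂ :=
  {z : ℂ | ‖z‖ ≤ 1 ∧ ∀ j, R j ≤ ‖z - lam j‖}

/-- The value `p(z, z̄) = ∑ p_{kl} z ^ k * z̄ ^ l` of a polynomial in `z` and `z̄`.
The variable `0` stands for `z`, the variable `1` for `z̄`. -/
noncomputable def polyVal (p : MvPolynomial (Fin 2) ℂ) (z : ℂ) : ℂ :=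
  ∑ s ∈ p.support, p.coeff s * (z ^ s 0 * (starRingEnd ℂ z) ^ s 1)

/-- The element `p(a, a*) = ∑ p_{kl} a ^ k (a*) ^ l`, with all powers of `a` to the left of
all powers of `a*`. -/
noncomputable def polyCalc {A : Type*} [CStarAlgebra A] (p : MvPolynomial (Fin 2) ℂ) (a : A) : A :=
  ∑ s ∈ p.support, p.coeff s • (a ^ s 0 * (star a) ^ s 1)

/-! The proof is by compactness and contradiction. If no `δ₀` works, there are counterexamples `a k`
in algebras `A k` with commutators tending to zero. The parameters `μ k` stay bounded, since a
Neumann series handles large ones, so a subsequence converges to some `ν`. In the C*-algebra of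
bounded sequences modulo null sequences the class of `a` is normal with spectrum in `S`, so
functional calculus inverts `p(a, a*) - ν` with norm at most `κ⁻¹` (`exists_inverse_polyCalc_sub`).
Lifting this inverse gives approximate inverses of almost the same norm for late terms, which are
therefore not counterexamples. -/

open Filter Topology
open scoped ENNReal

section QuotientNormedRing

variable {R : Type*} [NormedRing R]

/-- The quotient of a normed ring by a closed two-sided ideal is a normed ring. -/
noncomputable abbrev Ideal.Quotient.normedRingOfIsTwoSided (I : Ideal R) [I.IsTwoSided]
    [IsClosed (I : Set R)] : NormedRing (R ⧸ I) :=
  { Submodule.Quotient.normedAddCommGroup I, Ideal.Quotient.ring I with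
    norm_mul_le := fun x y => by
      refine le_of_forall_pos_le_add fun ε hε => ?_
      have hcont : Tendsto (fun t : ℝ => (‖x‖ + t) * (‖y‖ + t)) (𝓝[>] 0) (𝓝 (‖x‖ * ‖y‖)) := by
        have : Continuous fun t : ℝ => (‖x‖ + t) * (‖y‖ + t) := by fun_prop
        simpa using (this.tendsto 0).mono_left nhdsWithin_le_nhds
      obtain ⟨t, ht, ht0⟩ :=
        ((hcont.eventually (gt_mem_nhds (lt_add_of_pos_right _ hε))).and self_mem_nhdsWithin).exists
      obtain ⟨r, rfl, hr⟩ := Submodule.Quotient.norm_mk_lt (S := I) x ht0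
      obtain ⟨s, rfl, hs⟩ := Submodule.Quotient.norm_mk_lt (S := I) y ht0
      calc _ ≤ ‖r * s‖ := Submodule.Quotient.norm_mk_le I (r * s)
        _ ≤ ‖r‖ * ‖s‖ := norm_mul_le r s
        _ ≤ _ := (mul_le_mul hr.le hs.le (norm_nonneg _) (by positivity)).trans ht.le }

end QuotientNormedRing

/-! ### Bounded sequences modulo null sequences form a C*-algebra. -/

section BoundedSequences

variable (A : ℕ → Type*) [∀ n, CStarAlgebra (A n)] [∀ n, Nontrivial (A n)]

noncomputable instance lp.instCStarAlgebra : CStarAlgebra (lp A ∞) where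

/-- Evaluation of a bounded sequence at an index. -/
noncomputable def lp.evalStarAlgHom (n : ℕ) : lp A ∞ →⋆ₐ[ℂ] A n where
  toFun x := x n
  map_one' := rfl
  map_mul' _ _ := rfl
  map_zero' := rfl
  map_add' _ _ := rfl
  commutes' _ := rfl
  map_star' _ := rfl

/-- The ideal of null sequences in the algebra of bounded sequences. -/
noncomputable def nullIdeal : Ideal (lp A ∞) where
  carrier := {x | Tendsto (fun n => ‖x n‖) atTop (𝓝 0)}
  add_mem' {x y} hx hy := squeeze_zero (fun _ => norm_nonneg _)
    (fun n => norm_add_le (x n) (y n)) (by simpa using Tendsto.add hx hy)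
  zero_mem' := by simp
  smul_mem' c x hx := squeeze_zero (fun _ => norm_nonneg _)
    (fun n => (norm_mul_le (c n) (x n)).trans
      (mul_le_mul_of_nonneg_right (lp.norm_apply_le_norm (by simp) c n) (norm_nonneg _)))
    (by simpa using Tendsto.const_mul ‖c‖ hx)

variable {A}

theorem mem_nullIdeal {x : lp A ∞} : x ∈ nullIdeal A ↔ Tendsto (fun n => ‖x n‖) atTop (𝓝 0) :=
  Iff.rfl

theorem star_mem_nullIdeal {x : lp A ∞} (hx : x ∈ nullIdeal A) : star x ∈ nullIdeal A := by
  simpa [mem_nullIdeal] using hx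

instance nullIdeal.isTwoSided : (nullIdeal A).IsTwoSided where
  mul_mem_of_left {x} c hx := squeeze_zero (fun _ => norm_nonneg _)
    (fun n => (norm_mul_le (x n) (c n)).trans
      (mul_le_mul_of_nonneg_left (lp.norm_apply_le_norm (by simp) c n) (norm_nonneg _)))
    (by simpa using Tendsto.mul_const ‖c‖ (mem_nullIdeal.1 hx))

instance nullIdeal.isClosed : IsClosed (nullIdeal A : Set (lp A ∞)) := by
  refine isClosed_of_closure_subset fun x hx => ?_
  refine Metric.tendsto_atTop.2 fun ε hε => ?_
  obtain ⟨y, hy, hxy⟩ := Metric.mem_closure_iff.1 hx (ε / 2) (half_pos hε)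
  obtain ⟨N, hN⟩ := Metric.tendsto_atTop.1 (mem_nullIdeal.1 hy) (ε / 2) (half_pos hε)
  refine ⟨N, fun n hn => ?_⟩
  have h1 := hN n hn
  have h2 : ‖x n - y n‖ ≤ ‖x - y‖ := lp.norm_apply_le_norm (by simp) (x - y) n
  have h3 := norm_sub_norm_le (x n) (y n)
  rw [dist_eq_norm] at hxy
  simp only [dist_zero_right, norm_norm] at h1 ⊢
  linarith

variable (A) in
/-- Bounded sequences modulo null sequences. -/
def AsymptoticAlgebra : Type _ := lp A ∞ ⧸ nullIdeal A

namespace AsymptoticAlgebra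

noncomputable instance : NormedRing (AsymptoticAlgebra A) :=
  Ideal.Quotient.normedRingOfIsTwoSided (nullIdeal A)

instance : CompleteSpace (AsymptoticAlgebra A) :=
  Submodule.Quotient.completeSpace (nullIdeal A)

noncomputable instance : NormedAlgebra ℂ (AsymptoticAlgebra A) :=
  { Submodule.Quotient.normedSpace (nullIdeal A) ℂ, Ideal.Quotient.algebra ℂ with }

/-- The quotient map from bounded sequences. -/
noncomputable def mk : lp A ∞ →ₐ[ℂ] AsymptoticAlgebra A :=
  Ideal.Quotient.mkₐ ℂ (nullIdeal A)

theorem mk_surjective : Function.Surjective (mk (A := A)) := Ideal.Quotient.mk_surjective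

theorem mk_eq_mk_iff {x y : lp A ∞} :
    mk x = mk y ↔ Tendsto (fun n => ‖x n - y n‖) atTop (𝓝 0) :=
  Ideal.Quotient.eq

theorem norm_mk_le (x : lp A ∞) : ‖mk x‖ ≤ ‖x‖ := Submodule.Quotient.norm_mk_le (nullIdeal A) x

theorem exists_norm_lt (x : AsymptoticAlgebra A) {ε : ℝ} (hε : 0 < ε) :
    ∃ y, mk y = x ∧ ‖y‖ < ‖x‖ + ε :=
  Submodule.Quotient.norm_mk_lt (S := nullIdeal A) x hε

theorem norm_mk_le_of_eventually_le {x : lp A ∞} {c : ℝ} (hc : 0 ≤ c)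
    (h : ∀ᶠ n in atTop, ‖x n‖ ≤ c) : ‖mk x‖ ≤ c := by
  classical
  obtain ⟨N, hN⟩ := eventually_atTop.1 h
  have hb : ∀ n, ‖if N ≤ n then x n else 0‖ ≤ c := fun n => by
    split_ifs with hn
    · exact hN n hn
    · simpa using hc
  let y : lp A ∞ := ⟨fun n => if N ≤ n then x n else 0,
    memℓp_infty ⟨c, by rintro _ ⟨n, rfl⟩; exact hb n⟩⟩
  have hxy : mk x = mk y := mk_eq_mk_iff.2 <| tendsto_const_nhds.congr' <| by
    filter_upwards [eventually_ge_atTop N] with n hn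
    simp [y, hn]
  rw [hxy]
  exact (norm_mk_le y).trans (lp.norm_le_of_forall_le hc hb)

/-- With `norm_mk_le_of_eventually_le`, this identifies the quotient norm with the limit superior of
the norms of the terms. -/
theorem eventually_norm_lt {x : lp A ∞} {c : ℝ} (h : ‖mk x‖ < c) :
    ∀ᶠ n in atTop, ‖x n‖ < c := by
  obtain ⟨y, hy, hyc⟩ := exists_norm_lt (mk x) (half_pos (sub_pos.2 h))
  filter_upwards [(mk_eq_mk_iff.1 hy.symm).eventually
    (gt_mem_nhds (half_pos (sub_pos.2 h)))] with n hn
  have h1 : ‖y n‖ ≤ ‖y‖ := lp.norm_apply_le_norm (by simp) y n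
  have h2 := norm_sub_norm_le (x n) (y n)
  linarith

noncomputable instance : Star (AsymptoticAlgebra A) where
  star := Quotient.map' star fun x y h => by
    rw [Submodule.quotientRel_def] at h ⊢
    simpa using star_mem_nullIdeal h

theorem star_mk (x : lp A ∞) : star (mk x) = mk (star x) := rfl

noncomputable instance : StarRing (AsymptoticAlgebra A) where
  star_involutive x := by
    obtain ⟨x, rfl⟩ := mk_surjective x
    simp [star_mk]
  star_mul x y := by
    obtain ⟨x, rfl⟩ := mk_surjective x
    obtain ⟨y, rfl⟩ := mk_surjective y
    simp [star_mk, ← map_mul]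
  star_add x y := by
    obtain ⟨x, rfl⟩ := mk_surjective x
    obtain ⟨y, rfl⟩ := mk_surjective y
    simp [star_mk, ← map_add]

instance : StarModule ℂ (AsymptoticAlgebra A) where
  star_smul c x := by
    obtain ⟨x, rfl⟩ := mk_surjective x
    simp [star_mk, ← map_smul]

instance : CStarRing (AsymptoticAlgebra A) where
  norm_mul_self_le x := by
    obtain ⟨x, rfl⟩ := mk_surjective x
    -- The C*-identity is applied term by term along a tail, for each `c` above the quotient norm of
    -- `star x * x`.
    refine le_of_forall_gt_imp_ge_of_dense fun c hc => ?_
    rw [star_mk, ← map_mul] at hc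
    have hc0 : 0 ≤ c := (norm_nonneg _).trans hc.le
    have h : ‖mk x‖ ≤ √c := by
      refine norm_mk_le_of_eventually_le (Real.sqrt_nonneg c) ?_
      filter_upwards [eventually_norm_lt hc] with n hn
      refine Real.le_sqrt_of_sq_le ?_
      have : ‖star (x n) * x n‖ < c := hn
      rw [CStarRing.norm_star_mul_self] at this
      nlinarith
    calc ‖mk x‖ * ‖mk x‖ ≤ √c * √c := mul_self_le_mul_self (norm_nonneg _) h
      _ = c := Real.mul_self_sqrt hc0

noncomputable instance : CStarAlgebra (AsymptoticAlgebra A) where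
  __ : NormedRing (AsymptoticAlgebra A) := inferInstance
  __ : StarRing (AsymptoticAlgebra A) := inferInstance
  __ : CStarRing (AsymptoticAlgebra A) := inferInstance
  __ : CompleteSpace (AsymptoticAlgebra A) := inferInstance
  __ : NormedAlgebra ℂ (AsymptoticAlgebra A) := inferInstance
  __ : StarModule ℂ (AsymptoticAlgebra A) := inferInstance

variable (A) in
/-- The quotient map from bounded sequences, as a `*`-homomorphism. -/
noncomputable def mkStarAlgHom : lp A ∞ →⋆ₐ[ℂ] AsymptoticAlgebra A :=
  { mk with map_star' := fun _ => rfl }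

end AsymptoticAlgebra

end BoundedSequences

/-! ### Neumann series. -/

section ApproximateInverse

variable {A : Type*} [NormedRing A] [CompleteSpace A]

/-- An element with an approximate two-sided inverse `b` is invertible. -/
theorem isUnit_and_norm_inverse_le_of_norm_mul_sub_one {q b : A} {η : ℝ} (hη : η < 1)
    (h₁ : ‖1 - b * q‖ ≤ η) (h₂ : ‖1 - q * b‖ < 1) :
    IsUnit q ∧ ‖Ring.inverse q‖ ≤ ‖b‖ / (1 - η) := by
  have hu : IsUnit (b * q) := by simpa using isUnit_one_sub_of_norm_lt_one (h₁.trans_lt hη)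
  have hv : IsUnit (q * b) := by simpa using isUnit_one_sub_of_norm_lt_one h₂
  obtain ⟨u, hu⟩ := hu
  obtain ⟨v, hv⟩ := hv
  have hq : IsUnit q := by
    refine isUnit_iff_exists_and_exists.2 ⟨⟨b * ↑v⁻¹, ?_⟩, ⟨↑u⁻¹ * b, ?_⟩⟩
    · rw [← mul_assoc, ← hv, Units.mul_inv]
    · rw [mul_assoc, ← hu, Units.inv_mul]
  refine ⟨hq, ?_⟩
  -- This makes the norm of the inverse bound itself: it is at most `‖b‖` plus `η` times itself.
  have hinv : Ring.inverse q = b + (1 - b * q) * Ring.inverse q := by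
    rw [sub_mul, mul_assoc, Ring.mul_inverse_cancel q hq]
    simp
  have h := norm_add_le b ((1 - b * q) * Ring.inverse q)
  rw [← hinv] at h
  have h' := (norm_mul_le (1 - b * q) (Ring.inverse q)).trans
    (mul_le_mul_of_nonneg_right h₁ (norm_nonneg _))
  rw [le_div_iff₀ (by linarith)]
  linarith

end ApproximateInverse

/-! ### Resolvent bounds for large parameters and for normal elements. -/

section PolynomialCalculus

variable {A B : Type*} [CStarAlgebra A] [CStarAlgebra B] (p : MvPolynomial (Fin 2) ℂ)

theorem map_polyCalc (f : A →⋆ₐ[ℂ] B) (a : A) : f (polyCalc p a) = polyCalc p (f a) := by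
  simp [polyCalc, map_sum, map_smul, map_mul, map_pow, map_star]

theorem continuous_polyVal : Continuous (polyVal p) := by
  unfold polyVal
  fun_prop

theorem polyCalc_eq_cfc (a : A) [IsStarNormal a] : polyCalc p a = cfc (polyVal p) a := by
  have h : polyVal p = ∑ s ∈ p.support,
      fun z => p.coeff s • (z ^ s 0 * (star z) ^ s 1) := by
    ext z
    simp [polyVal]
  rw [h, cfc_sum _ _ _ fun s _ => by fun_prop, polyCalc]
  refine Finset.sum_congr rfl fun s _ => ?_
  rw [cfc_smul _ _ a (by fun_prop), cfc_mul _ _ a (by fun_prop) (by fun_prop),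
    cfc_pow_id (R := ℂ) a, cfc_pow _ _ a (by fun_prop), cfc_star_id (R := ℂ) (a := a)]

theorem norm_polyCalc_le [Nontrivial A] {a : A} (ha : ‖a‖ ≤ 1) :
    ‖polyCalc p a‖ ≤ ∑ s ∈ p.support, ‖p.coeff s‖ := by
  refine norm_sum_le_of_le _ fun s _ => ?_
  rw [norm_smul]
  refine mul_le_of_le_one_right (norm_nonneg _) ((norm_mul_le _ _).trans ?_)
  have h₁ : ‖a ^ s 0‖ ≤ 1 := (norm_pow_le a _).trans (pow_le_one₀ (norm_nonneg _) ha)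
  have h₂ : ‖star a ^ s 1‖ ≤ 1 :=
    (norm_pow_le _ _).trans (pow_le_one₀ (norm_nonneg _) (by rwa [norm_star]))
  exact mul_le_one₀ h₁ (norm_nonneg _) h₂

/-- The resolvent bound for spectral parameters far from the origin. -/
theorem isUnit_and_norm_inverse_polyCalc_sub_le [Nontrivial A] {a : A} (ha : ‖a‖ ≤ 1) {μ : ℂ}
    {κ : ℝ} (hκ : 0 < κ) (hμ : ∑ s ∈ p.support, ‖p.coeff s‖ + κ ≤ ‖μ‖) :
    IsUnit (polyCalc p a - algebraMap ℂ A μ) ∧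
      ‖Ring.inverse (polyCalc p a - algebraMap ℂ A μ)‖ ≤ κ⁻¹ := by
  set P := ∑ s ∈ p.support, ‖p.coeff s‖
  have hx : ‖polyCalc p a‖ ≤ P := norm_polyCalc_le p ha
  have hP : 0 ≤ P := (norm_nonneg _).trans hx
  have hμ0 : 0 < ‖μ‖ := by linarith
  have hμ' : μ ≠ 0 := norm_pos_iff.1 hμ0
  have hη : ‖μ⁻¹ • polyCalc p a‖ ≤ P / ‖μ‖ := by
    rw [norm_smul, norm_inv, inv_mul_eq_div]
    gcongr
  have hη1 : P / ‖μ‖ < 1 := (div_lt_one hμ0).2 (by linarith)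
  have h₁ : 1 - algebraMap ℂ A (-μ⁻¹) * (polyCalc p a - algebraMap ℂ A μ) =
      μ⁻¹ • polyCalc p a := by
    rw [mul_sub, ← map_mul, ← Algebra.smul_def]
    simp [hμ']
  have h₂ : 1 - (polyCalc p a - algebraMap ℂ A μ) * algebraMap ℂ A (-μ⁻¹) =
      μ⁻¹ • polyCalc p a := by
    rw [← Algebra.commutes, h₁]
  obtain ⟨hu, hle⟩ := isUnit_and_norm_inverse_le_of_norm_mul_sub_one hη1
    (b := algebraMap ℂ A (-μ⁻¹)) (by rwa [h₁]) (by rw [h₂]; exact hη.trans_lt hη1)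
  refine ⟨hu, hle.trans ?_⟩
  rw [norm_algebraMap', norm_neg, norm_inv, one_sub_div hμ0.ne', ← one_div,
    div_div_div_cancel_right₀ hμ0.ne', ← one_div]
  exact one_div_le_one_div_of_le hκ (by linarith)

/-- The spectrum of an element subject to the defining norm constraints lies in the holed disk. -/
theorem spectrum_subset_holedDisk [Nontrivial A] {n : ℕ} {lam : Fin n → ℂ} {R : Fin n → ℝ}
    (hR : ∀ j, 0 < R j) {a : A} (ha : ‖a‖ ≤ 1)
    (hinv : ∀ j, ∃ b, b * (a - algebraMap ℂ A (lam j)) = 1 ∧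
      (a - algebraMap ℂ A (lam j)) * b = 1 ∧ ‖b‖ ≤ (R j)⁻¹) :
    spectrum ℂ a ⊆ holedDisk lam R := by
  intro z hz
  refine ⟨(spectrum.norm_le_norm_of_mem hz).trans ha, fun j => ?_⟩
  obtain ⟨b, hb₁, hb₂, hb⟩ := hinv j
  let u : Aˣ := ⟨a - algebraMap ℂ A (lam j), b, hb₂, hb₁⟩
  have hzu : z - lam j ∈ spectrum ℂ (u : A) := by
    rw [sub_eq_add_neg]
    have := (spectrum.add_mem_add_iff (s := -lam j)).2 hz
    simpa [u, sub_eq_add_neg, add_comm] using this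
  have h0 : z - lam j ≠ 0 := fun h => spectrum.zero_notMem ℂ u.isUnit (h ▸ hzu)
  -- Spectral values are bounded by the norm, so the bound on the inverse keeps `z` out of the hole.
  have hzi : (z - lam j)⁻¹ ∈ spectrum ℂ (↑u⁻¹ : A) :=
    spectrum.inv_mem_iff (r := Units.mk0 _ h0) (a := u) |>.1 hzu
  have h := (spectrum.norm_le_norm_of_mem hzi).trans hb
  rw [norm_inv] at h
  exact (inv_le_inv₀ (norm_pos_iff.2 h0) (hR j)).1 h

/-- The resolvent bound for normal elements. -/
theorem exists_inverse_polyCalc_sub [Nontrivial A] {a : A} [IsStarNormal a] {S : Set ℂ}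
    (haS : spectrum ℂ a ⊆ S) {μ : ℂ} {κ : ℝ} (hκ : 0 < κ)
    (hμ : κ ≤ Metric.infDist μ (polyVal p '' S)) :
    ∃ b, b * (polyCalc p a - algebraMap ℂ A μ) = 1 ∧
      (polyCalc p a - algebraMap ℂ A μ) * b = 1 ∧ ‖b‖ ≤ κ⁻¹ := by
  have hdist : ∀ z ∈ spectrum ℂ a, κ ≤ ‖polyVal p z - μ‖ := fun z hz => by
    rw [← dist_eq_norm, dist_comm]
    exact hμ.trans (Metric.infDist_le_dist_of_mem (Set.mem_image_of_mem _ (haS hz)))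
  have hcont := continuous_polyVal p
  have hne : ∀ z ∈ spectrum ℂ a, polyVal p z - μ ≠ 0 := fun z hz =>
    norm_pos_iff.1 (hκ.trans_le (hdist z hz))
  have hq : polyCalc p a - algebraMap ℂ A μ = cfc (fun z => polyVal p z - μ) a := by
    rw [cfc_sub _ _ a (by fun_prop) (by fun_prop), cfc_const μ a, polyCalc_eq_cfc]
  have hunit : IsUnit (cfc (fun z => polyVal p z - μ) a) := by
    rwa [isUnit_cfc_iff _ a (by fun_prop)]
  refine ⟨Ring.inverse (cfc (fun z => polyVal p z - μ) a), ?_, ?_, ?_⟩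
  · rw [hq, Ring.inverse_mul_cancel _ hunit]
  · rw [hq, Ring.mul_inverse_cancel _ hunit]
  · rw [← cfc_inv _ a hne (by fun_prop)]
    refine norm_cfc_le (inv_nonneg.2 hκ.le) fun z hz => ?_
    rw [norm_inv]
    exact inv_anti₀ hκ (hdist z hz)

end PolynomialCalculus

/-! ### Transfer between sequences and the quotient. -/

section AsymptoticallyNormal

variable {A : ℕ → Type*} [∀ n, CStarAlgebra (A n)]

/-- A sequence bounded by a constant, as an element of `lp A ∞`. -/
def lp.ofNormLe (x : ∀ n, A n) (c : ℝ) (hx : ∀ n, ‖x n‖ ≤ c) : lp A ∞ :=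
  ⟨x, memℓp_infty ⟨c, by rintro _ ⟨n, rfl⟩; exact hx n⟩⟩

@[simp]
theorem lp.ofNormLe_apply (x : ∀ n, A n) (c : ℝ) (hx : ∀ n, ‖x n‖ ≤ c) (n : ℕ) :
    lp.ofNormLe x c hx n = x n := rfl

theorem lp.norm_ofNormLe_le (x : ∀ n, A n) {c : ℝ} (hx : ∀ n, ‖x n‖ ≤ c) :
    ‖lp.ofNormLe x c hx‖ ≤ c :=
  lp.norm_le_of_forall_le ((norm_nonneg _).trans (hx 0)) hx

variable [∀ n, Nontrivial (A n)]

theorem polyCalc_lp_apply (p : MvPolynomial (Fin 2) ℂ) (x : lp A ∞) (n : ℕ) :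
    polyCalc p x n = polyCalc p (x n) :=
  map_polyCalc p (lp.evalStarAlgHom A n) x

namespace AsymptoticAlgebra

instance : Nontrivial (AsymptoticAlgebra A) := by
  refine ⟨⟨mk 0, mk 1, fun h => ?_⟩⟩
  have h := mk_eq_mk_iff.1 h
  have h1 : ∀ n, ‖(0 : lp A ∞) n - (1 : lp A ∞) n‖ = 1 := fun n => by
    simp [lp.infty_coeFn_one]
  simp only [h1] at h
  exact one_ne_zero (tendsto_nhds_unique tendsto_const_nhds h)

/-- Invertibility modulo null sequences is eventual invertibility, with control of the norm. -/
theorem eventually_isUnit_and_norm_inverse_le (q : lp A ∞) {c : AsymptoticAlgebra A}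
    (hc₁ : c * mk q = 1) (hc₂ : mk q * c = 1) {K : ℝ} (hK : ‖c‖ < K) :
    ∀ᶠ n in atTop, IsUnit (q n) ∧ ‖Ring.inverse (q n)‖ ≤ K := by
  obtain ⟨b, rfl, hb⟩ := exists_norm_lt c (sub_pos.2 hK)
  rw [add_sub_cancel] at hb
  have hK0 : 0 < K := (norm_nonneg b).trans_lt hb
  have hη : 0 < 1 - ‖b‖ / K := sub_pos.2 ((div_lt_one hK0).2 hb)
  rw [← map_mul, ← map_one mk] at hc₁ hc₂
  have hleft : Tendsto (fun n => ‖1 - b n * q n‖) atTop (𝓝 0) := mk_eq_mk_iff.1 hc₁.symm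
  have hright : Tendsto (fun n => ‖1 - q n * b n‖) atTop (𝓝 0) := mk_eq_mk_iff.1 hc₂.symm
  -- An error `η ≤ 1 - ‖b‖ / K` gives `‖b‖ / (1 - η) ≤ K`; the cap `1 / 2` keeps `η < 1` when `‖b‖ =
  -- 0`.
  filter_upwards [hleft.eventually (gt_mem_nhds (show 0 < min (1 - ‖b‖ / K) (1 / 2) by positivity)),
    hright.eventually (gt_mem_nhds one_pos)] with n hn₁ hn₂
  obtain ⟨hu, hle⟩ := isUnit_and_norm_inverse_le_of_norm_mul_sub_one
    (lt_of_le_of_lt (min_le_right _ _) one_half_lt_one) hn₁.le hn₂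
  refine ⟨hu, hle.trans ?_⟩
  have hmin : min (1 - ‖b‖ / K) (1 / 2) < 1 := lt_of_le_of_lt (min_le_right _ _) one_half_lt_one
  rw [div_le_iff₀ (by linarith)]
  calc ‖b n‖ ≤ ‖b‖ := lp.norm_apply_le_norm (by simp) b n
    _ = K * (1 - (1 - ‖b‖ / K)) := by field_simp; ring
    _ ≤ _ := by gcongr; exact min_le_left _ _

theorem mk_ofNormLe_algebraMap {μ : ℕ → ℂ} {ν : ℂ} (hμ : Tendsto μ atTop (𝓝 ν)) (M : ℝ)
    (hM : ∀ n, ‖algebraMap ℂ (A n) (μ n)‖ ≤ M) :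
    mk (lp.ofNormLe (fun n => algebraMap ℂ (A n) (μ n)) M hM) =
      algebraMap ℂ (AsymptoticAlgebra A) ν := by
  rw [← AlgHom.commutes mk, mk_eq_mk_iff]
  have h : ∀ n, ‖algebraMap ℂ (A n) (μ n) - algebraMap ℂ (A n) ν‖ = ‖μ n - ν‖ := fun n => by
    rw [← map_sub, norm_algebraMap']
  exact (tendsto_iff_norm_sub_tendsto_zero.1 hμ).congr fun n => (h n).symm

theorem mk_polyCalc (p : MvPolynomial (Fin 2) ℂ) (x : lp A ∞) :
    mk (polyCalc p x) = polyCalc p (mk x) :=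
  map_polyCalc p (mkStarAlgHom A) x

theorem isStarNormal_mk (x : lp A ∞)
    (hx : Tendsto (fun n => ‖x n * star (x n) - star (x n) * x n‖) atTop (𝓝 0)) :
    IsStarNormal (mk x) := by
  have h : mk (x * star x) = mk (star x * x) := mk_eq_mk_iff.2 hx
  refine ⟨?_⟩
  rw [commute_iff_eq, star_mk, ← map_mul, ← map_mul, h]

theorem spectrum_mk_subset_holedDisk {m : ℕ} {lam : Fin m → ℂ} {R : Fin m → ℝ}
    (hR : ∀ j, 0 < R j) (x : lp A ∞) (hx : ∀ n, ‖x n‖ ≤ 1)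
    (hinv : ∀ n j, IsUnit (x n - algebraMap ℂ (A n) (lam j)) ∧
      ‖Ring.inverse (x n - algebraMap ℂ (A n) (lam j))‖ ≤ (R j)⁻¹) :
    spectrum ℂ (mk x) ⊆ holedDisk lam R := by
  refine spectrum_subset_holedDisk hR
    ((norm_mk_le x).trans (lp.norm_le_of_forall_le zero_le_one hx)) fun j => ?_
  let b : lp A ∞ := lp.ofNormLe (fun n => Ring.inverse (x n - algebraMap ℂ (A n) (lam j))) (R j)⁻¹
    fun n => (hinv n j).2
  have h₁ : b * (x - algebraMap ℂ (lp A ∞) (lam j)) = 1 := lp.ext <| funext fun n =>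
    Ring.inverse_mul_cancel _ (hinv n j).1
  have h₂ : (x - algebraMap ℂ (lp A ∞) (lam j)) * b = 1 := lp.ext <| funext fun n =>
    Ring.mul_inverse_cancel _ (hinv n j).1
  rw [← AlgHom.commutes mk (lam j), ← map_sub]
  refine ⟨mk b, ?_, ?_, (norm_mk_le b).trans (lp.norm_ofNormLe_le _ fun n => (hinv n j).2)⟩
  · rw [← map_mul, h₁, map_one]
  · rw [← map_mul, h₂, map_one]

end AsymptoticAlgebra

/-- The resolvent bound, up to an arbitrarily small error, along a sequence of asymptotically
normal elements. -/
theorem eventually_isUnit_and_norm_inverse_le {m : ℕ} {lam : Fin m → ℂ} {R : Fin m → ℝ}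
    (hR : ∀ j, 0 < R j) (p : MvPolynomial (Fin 2) ℂ) {ε κ : ℝ} (hε : 0 < ε) (hκ : 0 < κ)
    (a : ∀ n, A n) (ha : ∀ n, ‖a n‖ ≤ 1)
    (hcomm : Tendsto (fun n => ‖a n * star (a n) - star (a n) * a n‖) atTop (𝓝 0))
    (hinv : ∀ n j, IsUnit (a n - algebraMap ℂ (A n) (lam j)) ∧
      ‖Ring.inverse (a n - algebraMap ℂ (A n) (lam j))‖ ≤ (R j)⁻¹)
    {μ : ℕ → ℂ} {ν : ℂ} (hμ : Tendsto μ atTop (𝓝 ν))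
    (hν : κ ≤ Metric.infDist ν (polyVal p '' holedDisk lam R)) :
    ∀ᶠ n in atTop, IsUnit (polyCalc p (a n) - algebraMap ℂ (A n) (μ n)) ∧
      ‖Ring.inverse (polyCalc p (a n) - algebraMap ℂ (A n) (μ n))‖ ≤ κ⁻¹ + ε := by
  obtain ⟨x, hx⟩ : ∃ x : lp A ∞, ∀ n, x n = a n := ⟨lp.ofNormLe a 1 ha, fun _ => rfl⟩
  simp only [← hx] at ha hcomm hinv ⊢
  have hnormal := AsymptoticAlgebra.isStarNormal_mk x hcomm
  obtain ⟨c, hc₁, hc₂, hc⟩ := exists_inverse_polyCalc_sub p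
    (AsymptoticAlgebra.spectrum_mk_subset_holedDisk hR x ha hinv) hκ hν
  obtain ⟨M, hM⟩ := (Metric.isBounded_range_of_tendsto μ hμ).exists_norm_le
  have hM' : ∀ n, ‖algebraMap ℂ (A n) (μ n)‖ ≤ M := fun n => by
    simpa using hM _ (Set.mem_range_self n)
  have hq : AsymptoticAlgebra.mk (polyCalc p x - lp.ofNormLe _ M hM') =
      polyCalc p (AsymptoticAlgebra.mk x) - algebraMap ℂ (AsymptoticAlgebra A) ν := by
    rw [map_sub, AsymptoticAlgebra.mk_ofNormLe_algebraMap hμ M hM', AsymptoticAlgebra.mk_polyCalc]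
  filter_upwards [AsymptoticAlgebra.eventually_isUnit_and_norm_inverse_le
    (polyCalc p x - lp.ofNormLe _ M hM') (by rw [hq, hc₁]) (by rw [hq, hc₂])
    (hc.trans_lt (lt_add_of_pos_right _ hε))] with n hn
  rwa [lp.coeFn_sub, Pi.sub_apply, polyCalc_lp_apply, lp.ofNormLe_apply] at hn

end AsymptoticallyNormal

-- Contradiction along a sequence of counterexamples.

universe u

/-- The resolvent bound for almost normal elements. A further error term linear in the norm of the
commutator is not needed, since shrinking `δ₀` absorbs it into `ε`. -/
theorem exists_isUnit_and_norm_inverse_le {n : ℕ} (lam : Fin n → ℂ) (R : Fin n → ℝ)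
    (hR : ∀ j, 0 < R j) (p : MvPolynomial (Fin 2) ℂ)
    {ε : ℝ} (hε : 0 < ε) {κ : ℝ} (hκ : 0 < κ) :
    ∃ δ₀ : ℝ, 0 < δ₀ ∧ ∀ (A : Type u) [CStarAlgebra A] (μ : ℂ) (a : A),
      κ ≤ Metric.infDist μ (polyVal p '' holedDisk lam R) → ‖a‖ ≤ 1 →
      ‖a * star a - star a * a‖ < δ₀ →
      (∀ j, IsUnit (a - algebraMap ℂ A (lam j)) ∧
        ‖Ring.inverse (a - algebraMap ℂ A (lam j))‖ ≤ (R j)⁻¹) →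
      IsUnit (polyCalc p a - algebraMap ℂ A μ) ∧
        ‖Ring.inverse (polyCalc p a - algebraMap ℂ A μ)‖ ≤ κ⁻¹ + ε := by
  by_contra! hcon
  have hpos : ∀ k : ℕ, (0 : ℝ) < 1 / (k + 1) := fun k => Nat.one_div_pos_of_nat
  choose A inst μ a hμ ha hcomm hinv hbad using fun k : ℕ => hcon _ (hpos k)
  -- In the zero algebra everything is invertible with inverse of norm zero, so it yields no
  -- counterexample.
  have hnontriv : ∀ k, Nontrivial (A k) := fun k => by
    rcases subsingleton_or_nontrivial (A k) with _ | h
    · refine absurd (hbad k (isUnit_of_subsingleton _)) (not_lt.2 ?_)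
      rw [Subsingleton.elim (Ring.inverse _) (0 : A k), norm_zero]
      positivity
    · exact h
  have hbounded : ∀ k, μ k ∈ Metric.closedBall (0 : ℂ) (∑ s ∈ p.support, ‖p.coeff s‖ + κ) :=
    fun k => by
      rw [mem_closedBall_zero_iff]
      by_contra! h
      obtain ⟨hu, hle⟩ := isUnit_and_norm_inverse_polyCalc_sub_le p (ha k) hκ h.le
      linarith [hbad k hu]
  obtain ⟨ν, -, φ, hφ, hlim⟩ := (isCompact_closedBall _ _).tendsto_subseq hbounded
  -- The distance to a set is continuous, so the separation `κ` survives in the limit.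
  have hν : κ ≤ Metric.infDist ν (polyVal p '' holedDisk lam R) :=
    ge_of_tendsto' (((Metric.continuous_infDist_pt _).tendsto ν).comp hlim) fun k => hμ (φ k)
  have hcomm' : Tendsto (fun k => ‖a (φ k) * star (a (φ k)) - star (a (φ k)) * a (φ k)‖)
      atTop (𝓝 0) :=
    (squeeze_zero (fun _ => norm_nonneg _) (fun k => (hcomm k).le)
      tendsto_one_div_add_atTop_nhds_zero_nat).comp hφ.tendsto_atTop
  obtain ⟨k, hu, hle⟩ := (eventually_isUnit_and_norm_inverse_le hR p hε hκ (fun k => a (φ k))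
    (fun k => ha (φ k)) hcomm' (fun k => hinv (φ k)) hlim hν).exists
  exact (hbad (φ k) hu).not_ge hle

theorem theorem3 {n : ℕ} (lam : Fin n → ℂ) (R : Fin n → ℝ) (hR : ∀ j, 0 < R j)
    (hS : (holedDisk lam R).Nonempty) (p : MvPolynomial (Fin 2) ℂ)
    (ε : ℝ) (hε : 0 < ε) (κ : ℝ) (hκ : 0 < κ) :
    ∃ C δ₀ : ℝ, 0 < δ₀ ∧
      ∀ (A : Type*) [CStarAlgebra A] (δ : ℝ) (μ : ℂ) (a : A),
        δ < δ₀ →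
        κ ≤ Metric.infDist μ (polyVal p '' holedDisk lam R) →
        ‖a‖ ≤ 1 →
        ‖a * star a - star a * a‖ ≤ δ →
        (∀ j, IsUnit (a - algebraMap ℂ A (lam j)) ∧
          ‖Ring.inverse (a - algebraMap ℂ A (lam j))‖ ≤ (R j)⁻¹) →
        IsUnit (polyCalc p a - algebraMap ℂ A μ) ∧
          ‖Ring.inverse (polyCalc p a - algebraMap ℂ A μ)‖ ≤ κ⁻¹ + ε + C * δ := by
  obtain ⟨δ₀, hδ₀, h⟩ := exists_isUnit_and_norm_inverse_le lam R hR p hε hκ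
  -- `C = 0` suffices because `ε` already absorbs the whole error.
  refine ⟨0, δ₀, hδ₀, fun A _ δ μ a hδ hμ ha hcomm hinv => ?_⟩
  rw [zero_mul, add_zero]
  exact h A μ a hμ ha (hcomm.trans_lt hδ) hinv
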